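/- Let $\mathfrak g$ be a real Lie algebra. A para-hypercomplex structure on $\mathfrak g$ is a pair $(J_1,J_2)$ of $\mathbb R$-linear endomorphisms of $\mathfrak g$ with $J_1^2=-1$, $J_2^2=1$, $J_2\neq\pm1$, $J_1J_2=-J_2J_1$, which are integrable, i.e. for all $X,Y\in\mathfrak g$ $$[J_1X,J_1Y]-J_1[X,J_1Y]-J_1[J_1X,Y]-[X,Y]=0,$$ $$[J_2X,J_2Y]-J_2[X,J_2Y]-J_2[J_2X,Y]+[X,Y]=0.$$ Corollary 3.1. Up to isomorphism, $\mathbb R\oplus\mathfrak{sl}_2(\mathbb R)$ is the only non-solvable real $4$-dimensional Lie algebra admitting a para-hypercomplex structure: a real Lie algebra $\mathfrak g$ is $4$-dimensional, non-solvable and admits a para-hypercomplex structure if and only if $\mathfrak g\cong\mathbb R\oplus\mathfrak{sl}_2(\mathbb R)$. In particular, $\mathbb R\oplus\mathfrak{so}(3)$ admits no para-hypercomplex structure. -/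

import Mathlib

/- Associative algebras, such as `ℝ` and real matrices, carry the commutator bracket. -/
attribute [local instance 100] LieRing.ofAssociativeRing

/-- A complex structure on a real vector space: an endomorphism `J` with `J² = -1`. -/
def IsComplexStructure {V : Type*} [AddCommGroup V] [Module ℝ V] (J : V →ₗ[ℝ] V) : Prop :=
  J ∘ₗ J = -LinearMap.id

/-- A product structure on a real vector space: an endomorphism `J` with `J² = 1`, `J ≠ ±1`. -/
def IsProductStructure {V : Type*} [AddCommGroup V] [Module ℝ V] (J : V →ₗ[ℝ] V) : Prop :=
  J ∘ₗ J = LinearMap.id ∧ J ≠ LinearMap.id ∧ J ≠ -LinearMap.id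

/-- A complex structure on a Lie algebra is integrable if its Nijenhuis tensor vanishes. -/
def IsIntegrableComplex {g : Type*} [LieRing g] [LieAlgebra ℝ g] (J : g →ₗ[ℝ] g) : Prop :=
  ∀ x y : g, ⁅J x, J y⁆ - J ⁅x, J y⁆ - J ⁅J x, y⁆ - ⁅x, y⁆ = 0

/-- A product structure on a Lie algebra is integrable if its Nijenhuis tensor vanishes. -/
def IsIntegrableProduct {g : Type*} [LieRing g] [LieAlgebra ℝ g] (J : g →ₗ[ℝ] g) : Prop :=
  ∀ x y : g, ⁅J x, J y⁆ - J ⁅x, J y⁆ - J ⁅J x, y⁆ + ⁅x, y⁆ = 0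

/-- A para-hypercomplex structure on a real Lie algebra: a pair consisting of an integrable
complex structure and an integrable product structure which anti-commute. -/
structure IsParaHypercomplex {g : Type*} [LieRing g] [LieAlgebra ℝ g]
    (J₁ J₂ : g →ₗ[ℝ] g) : Prop where
  isComplex : IsComplexStructure J₁
  isProduct : IsProductStructure J₂
  anticomm : J₁ ∘ₗ J₂ = -(J₂ ∘ₗ J₁)
  integrable₁ : IsIntegrableComplex J₁
  integrable₂ : IsIntegrableProduct J₂

/-- The Lie algebra `g` admits a para-hypercomplex structure. -/
def AdmitsParaHypercomplex (g : Type*) [LieRing g] [LieAlgebra ℝ g] : Prop :=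
  ∃ J₁ J₂ : g →ₗ[ℝ] g, IsParaHypercomplex J₁ J₂

/-- The Lie algebra `ℝ ⊕ sl₂(ℝ)`, with `ℝ` the abelian one-dimensional Lie algebra and the
componentwise bracket. -/
abbrev RSumSl2 : Type := ℝ × LieAlgebra.SpecialLinear.sl (Fin 2) ℝ

/-- The Lie algebra `ℝ ⊕ so(3)`, with `so(3)` the skew-symmetric real `3 × 3` matrices. -/
abbrev RSumSo3 : Type := ℝ × LieAlgebra.Orthogonal.so (Fin 3) ℝ

/-!
Let `g` be a four-dimensional non-solvable Lie algebra with a para-hypercomplex structure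
`(J₁, J₂)`. Three facts determine it.

* `g` has a nonzero central element `v` (`exists_central_of_not_isSolvable`). Modulo its radical
  `g` has dimension at least three, so the radical is zero or a line. A line must be central, or `g`
  would be solvable. If the radical is zero, the Killing form `κ` is nondegenerate by Cartan's
  criterion, and the alternating 3-form `κ([x, y], z)`, which has a nonzero kernel for reasons of
  dimension, yields a central vector (`exists_central_of_isKilling`).
* The eigenspaces of `J₂` are complementary subalgebras, interchanged by `J₁` and hence of dimension
  two. One of them does not contain `v`
  (`AdmitsParaHypercomplex.exists_linearIndependent`).
* In a basis adapted to `v` and this subalgebra, the Jacobi identity and non-solvability leave only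
  the relations of an `sl₂`-triple complementary to `v` (`exists_sl2_triple`).

Conversely `ℝ ⊕ sl₂(ℝ)` is the algebra of `2 × 2` matrices, that is, of split quaternions, where left
multiplications by two anticommuting units with squares `-1` and `1` form a para-hypercomplex
structure (`admitsParaHypercomplex_matrix`).

For `ℝ ⊕ so(3)`, the second fact would give a two-dimensional subalgebra of `so(3)`, but a cross
product of independent vectors never lies in their span (`not_admitsParaHypercomplex_rSumSo3`).
-/

/-! ### Solvability from small derived ideals -/

theorem Submodule.exists_le_span_pair {V : Type*} [AddCommGroup V] [Module ℝ V]
    [Module.Finite ℝ V] (K : Submodule ℝ V) (hK : Module.finrank ℝ K ≤ 2) :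
    ∃ a b : V, K ≤ Submodule.span ℝ {a, b} := by
  obtain ⟨n, hn⟩ : ∃ n, Module.finrank ℝ K = n := ⟨_, rfl⟩
  let β := Module.finBasisOfFinrankEq ℝ K hn
  -- A basis of `K` padded with zeros covers the dimensions 0, 1 and 2 at once.
  let f : ℕ → V := fun i ↦ if h : i < n then β ⟨i, h⟩ else 0
  refine ⟨f 0, f 1, fun x hx ↦ ?_⟩
  have hsum := congrArg Subtype.val (β.sum_repr ⟨x, hx⟩)
  rw [hn] at hK
  have hf (i : Fin n) : f i = β i := by simp [f]
  simp only [AddSubmonoidClass.coe_finsetSum, SetLike.val_smul, ← hf] at hsum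
  rw [← hsum]
  refine Submodule.sum_mem _ fun i _ ↦ Submodule.smul_mem _ _ (Submodule.subset_span ?_)
  have : (i : ℕ) = 0 ∨ (i : ℕ) = 1 := by omega
  rcases this with h | h <;> simp [h]

section Solvable

variable {g : Type*} [LieRing g] [LieAlgebra ℝ g]

/-- Bounds the derived series by a chain of subspaces, which need not be ideals. -/
theorem derivedSeries_succ_le {k : ℕ} {U W : Submodule ℝ g}
    (hU : (LieAlgebra.derivedSeries ℝ g k).toSubmodule ≤ U)
    (hW : ∀ x ∈ U, ∀ y ∈ U, ⁅x, y⁆ ∈ W) :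
    (LieAlgebra.derivedSeries ℝ g (k + 1)).toSubmodule ≤ W := by
  rw [LieAlgebra.derivedSeries_def, LieAlgebra.derivedSeriesOfIdeal_succ,
    LieSubmodule.lieIdeal_oper_eq_linear_span', Submodule.span_le]
  rintro _ ⟨x, hx, y, hy, rfl⟩
  exact hW x (hU hx) y (hU hy)

theorem lie_mem_span_of_mem_span_pair {a b x y : g} (hx : x ∈ Submodule.span ℝ {a, b})
    (hy : y ∈ Submodule.span ℝ {a, b}) : ⁅x, y⁆ ∈ Submodule.span ℝ {⁅a, b⁆} := by
  obtain ⟨s, t, rfl⟩ := Submodule.mem_span_pair.mp hx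
  obtain ⟨s', t', rfl⟩ := Submodule.mem_span_pair.mp hy
  refine Submodule.mem_span_singleton.mpr ⟨s * t' - t * s', ?_⟩
  simp only [lie_add, add_lie, lie_smul, smul_lie, lie_self, ← lie_skew a b]
  module

/-- All brackets of elements of a plane lie on one line, so a planar term of the derived series is
followed by zero after two steps. -/
theorem isSolvable_of_derivedSeries_le_span_pair {k : ℕ} {a b : g}
    (h : (LieAlgebra.derivedSeries ℝ g k).toSubmodule ≤ Submodule.span ℝ {a, b}) :
    LieAlgebra.IsSolvable g := by
  have h₁ := derivedSeries_succ_le h fun x hx y hy ↦ lie_mem_span_of_mem_span_pair hx hy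
  have h₂ : (LieAlgebra.derivedSeries ℝ g (k + 1 + 1)).toSubmodule ≤ ⊥ := by
    refine derivedSeries_succ_le h₁ fun x hx y hy ↦ ?_
    obtain ⟨s, rfl⟩ := Submodule.mem_span_singleton.mp hx
    obtain ⟨t, rfl⟩ := Submodule.mem_span_singleton.mp hy
    simp
  refine LieAlgebra.IsSolvable.mk (R := ℝ) (k := k + 1 + 1) ?_
  rw [← LieSubmodule.toSubmodule_eq_bot]
  exact le_bot_iff.mp h₂

theorem isSolvable_of_finrank_le_two [Module.Finite ℝ g] (h : Module.finrank ℝ g ≤ 2) :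
    LieAlgebra.IsSolvable g := by
  obtain ⟨a, b, hab⟩ := (⊤ : Submodule ℝ g).exists_le_span_pair (by simpa using h)
  exact isSolvable_of_derivedSeries_le_span_pair (k := 0) (le_top.trans hab)

theorem isSolvable_of_ideal_of_quotient (I : LieIdeal ℝ g) [LieAlgebra.IsSolvable I]
    [LieAlgebra.IsSolvable (g ⧸ I)] : LieAlgebra.IsSolvable g := by
  obtain ⟨k, hk⟩ := LieAlgebra.IsSolvable.solvable ℝ (g ⧸ I)
  obtain ⟨l, hl⟩ := LieAlgebra.IsSolvable.solvable ℝ I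
  rw [LieIdeal.derivedSeries_eq_bot_iff] at hl
  have hle : LieAlgebra.derivedSeries ℝ g k ≤ I := by
    let π : g →ₗ⁅ℝ⁆ g ⧸ I :=
      { (LieSubmodule.Quotient.mk' I : g →ₗ[ℝ] g ⧸ I) with
        map_lie' := fun {x y} ↦ LieSubmodule.Quotient.mk_bracket (I := I) x y }
    have hmap := LieIdeal.derivedSeries_map_le (f := π) k
    rw [hk, le_bot_iff, LieIdeal.map_eq_bot_iff] at hmap
    exact fun x hx ↦ (LieSubmodule.Quotient.mk_eq_zero (N := I)).mp (hmap hx)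
  refine LieAlgebra.IsSolvable.mk (R := ℝ) (k := l + k) ?_
  rw [LieAlgebra.derivedSeries_def, LieAlgebra.derivedSeriesOfIdeal_add, ← le_bot_iff, ← hl]
  exact LieAlgebra.derivedSeriesOfIdeal_mono hle l

end Solvable

/-! ### Central elements in dimension four -/

section Central

variable {g : Type*} [LieRing g] [LieAlgebra ℝ g]

/-- The hypotheses on `w` say that it holds the coordinates of an alternating 3-form in dimension
four; if the three independent coordinates starting with `0` vanish, so does the contraction with
the first basis vector. -/
theorem alternating_eq_zero (w : Fin 4 → Fin 4 → Fin 4 → ℝ) (hskew : ∀ i j k, w i j k = -w j i k)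
    (hcyc : ∀ i j k, w i j k = w j k i) (h₁ : w 0 1 2 = 0) (h₂ : w 0 1 3 = 0) (h₃ : w 0 2 3 = 0)
    (j k : Fin 4) : w 0 j k = 0 := by
  fin_cases j <;> fin_cases k <;> simp only [Fin.mk_zero, Fin.mk_one, Fin.reduceFinMk] <;> grind

/-- An alternating 3-form `w` in dimension four is the contraction of the volume form with a vector,
and that vector, with coordinates `(w₁₂₃, -w₀₂₃, w₀₁₃, -w₀₁₂)`, lies in the kernel of `w`. -/
theorem alternating_contraction_eq_zero (w : Fin 4 → Fin 4 → Fin 4 → ℝ)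
    (hskew : ∀ i j k, w i j k = -w j i k) (hcyc : ∀ i j k, w i j k = w j k i) (j k : Fin 4) :
    w 1 2 3 * w 0 j k - w 0 2 3 * w 1 j k + w 0 1 3 * w 2 j k - w 0 1 2 * w 3 j k = 0 := by
  have h₁ (i k) : w i i k = 0 := by linarith [hskew i i k]
  have h₂ (i k) : w i k k = 0 := by rw [hcyc, h₁]
  have h₃ (i k) : w i k i = 0 := by rw [hcyc, h₂]
  have hperm (a b c) : w b c a = w a b c ∧ w c a b = w a b c ∧ w b a c = -w a b c ∧
      w a c b = -w a b c ∧ w c b a = -w a b c :=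
    ⟨by rw [← hcyc], by rw [hcyc], by rw [hskew], by rw [hcyc, hskew, ← hcyc, hcyc],
      by rw [hskew, ← hcyc]⟩
  obtain ⟨a₁, a₂, a₃, a₄, a₅⟩ := hperm 0 1 2
  obtain ⟨b₁, b₂, b₃, b₄, b₅⟩ := hperm 0 1 3
  obtain ⟨c₁, c₂, c₃, c₄, c₅⟩ := hperm 0 2 3
  obtain ⟨d₁, d₂, d₃, d₄, d₅⟩ := hperm 1 2 3
  fin_cases j <;> fin_cases k <;>
    simp only [Fin.mk_zero, Fin.mk_one, Fin.reduceFinMk, h₁, h₂, h₃, a₁, a₂, a₃, a₄, a₅, b₁, b₂,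
      b₃, b₄, b₅, c₁, c₂, c₃, c₄, c₅, d₁, d₂, d₃, d₄, d₅] <;> ring

/-- With `κ` the Killing form, `κ([x, y], z)` is an alternating 3-form. In dimension four it has a
nonzero kernel vector `v`, and `κ([v, y], z) = 0` for all `y`, `z` makes `v` central when `κ` is
nondegenerate. -/
theorem exists_central_of_isKilling [LieAlgebra.IsKilling ℝ g] (h4 : Module.finrank ℝ g = 4) :
    ∃ v : g, v ≠ 0 ∧ ∀ x : g, ⁅v, x⁆ = 0 := by
  have : Module.Finite ℝ g := Module.finite_of_finrank_pos (by omega)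
  let b := Module.finBasisOfFinrankEq ℝ g h4
  let κ := killingForm ℝ g
  let w : Fin 4 → Fin 4 → Fin 4 → ℝ := fun i j k ↦ κ ⁅b i, b j⁆ (b k)
  have hskew (i j k) : w i j k = -w j i k := by
    simp only [w]; rw [← lie_skew, map_neg, LinearMap.neg_apply]
  have hcyc (i j k) : w i j k = w j k i := by
    simp only [w, κ, killingForm]
    rw [LieModule.traceForm_apply_lie_apply, LieModule.traceForm_comm]
  have hcentral (v : g) (hv : ∀ j k, κ ⁅v, b j⁆ (b k) = 0) (x : g) : ⁅v, x⁆ = 0 := by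
    have hj (j : Fin 4) : ⁅v, b j⁆ = 0 :=
      (LieAlgebra.IsKilling.killingForm_nondegenerate ℝ g).1 _ fun y ↦ by
        have : κ ⁅v, b j⁆ = 0 := b.ext fun k ↦ by simpa using hv j k
        exact LinearMap.congr_fun this y
    have : LieAlgebra.ad ℝ g v = 0 := b.ext fun j ↦ by simpa using hj j
    simpa using LinearMap.congr_fun this x
  -- The kernel vector of the second case vanishes when the form does, so the case where it could
  -- be zero is treated apart.
  by_cases h0 : w 0 1 2 = 0 ∧ w 0 1 3 = 0 ∧ w 0 2 3 = 0
  · refine ⟨b 0, b.ne_zero 0, hcentral _ fun j k ↦ ?_⟩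
    exact alternating_eq_zero w hskew hcyc h0.1 h0.2.1 h0.2.2 j k
  · refine ⟨w 1 2 3 • b 0 - w 0 2 3 • b 1 + w 0 1 3 • b 2 - w 0 1 2 • b 3, ?_, ?_⟩
    · intro hv
      have hli := Fintype.linearIndependent_iff.mp b.linearIndependent
        ![w 1 2 3, -w 0 2 3, w 0 1 3, -w 0 1 2] (by
          simp only [Fin.sum_univ_four, Matrix.cons_val]
          rw [← hv]; module)
      apply h0
      have h1 := hli 1
      have h2 := hli 2
      have h3 := hli 3
      simp only [Matrix.cons_val, neg_eq_zero] at h1 h2 h3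
      exact ⟨h3, h2, h1⟩
    · refine hcentral _ fun j k ↦ ?_
      have : κ ⁅w 1 2 3 • b 0 - w 0 2 3 • b 1 + w 0 1 3 • b 2 - w 0 1 2 • b 3, b j⁆ (b k)
          = w 1 2 3 * w 0 j k - w 0 2 3 * w 1 j k + w 0 1 3 * w 2 j k - w 0 1 2 * w 3 j k := by
        simp [w]
      rw [this]
      exact alternating_contraction_eq_zero w hskew hcyc j k

/-- The radical has dimension at most one, since the quotient by it is not solvable. If it is zero,
Cartan's criterion makes the Killing form nondegenerate. If it is a line `ℝ r` with `r` not central,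
then the centralizer of `r` has dimension at most three, contains the derived algebra, and has `r` in
its centre; its brackets therefore span at most a line, and the algebra is solvable. -/
theorem exists_central_of_not_isSolvable (h4 : Module.finrank ℝ g = 4)
    (hns : ¬ LieAlgebra.IsSolvable g) : ∃ v : g, v ≠ 0 ∧ ∀ x : g, ⁅v, x⁆ = 0 := by
  have : Module.Finite ℝ g := Module.finite_of_finrank_pos (by omega)
  by_cases hR : LieAlgebra.radical ℝ g = ⊥
  · have : LieAlgebra.HasTrivialRadical ℝ g := ⟨hR⟩
    exact exists_central_of_isKilling h4
  have hsum := (LieAlgebra.radical ℝ g).toSubmodule.finrank_quotient_add_finrank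
  have hlt : ¬ Module.finrank ℝ (g ⧸ LieAlgebra.radical ℝ g) ≤ 2 := fun hle ↦ by
    have := isSolvable_of_finrank_le_two hle
    exact hns (isSolvable_of_ideal_of_quotient (LieAlgebra.radical ℝ g))
  have hpos : Module.finrank ℝ (LieAlgebra.radical ℝ g).toSubmodule ≠ 0 := fun h0 ↦ by
    rw [Submodule.finrank_eq_zero, LieSubmodule.toSubmodule_eq_bot] at h0
    exact hR h0
  have h1 : Module.finrank ℝ (LieAlgebra.radical ℝ g).toSubmodule = 1 := by
    change _ + _ = _ at hsum
    have : Module.finrank ℝ (g ⧸ (LieAlgebra.radical ℝ g).toSubmodule)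
      = Module.finrank ℝ (g ⧸ LieAlgebra.radical ℝ g) := rfl
    omega
  obtain ⟨⟨r, hr⟩, hr0, hspan⟩ := finrank_eq_one_iff'.mp h1
  have hr0' : r ≠ 0 := fun h ↦ hr0 (Subtype.ext h)
  refine ⟨r, hr0', ?_⟩
  by_contra! hx₀
  obtain ⟨x₀, hx₀⟩ := hx₀
  have hchar (x : g) : ∃ c : ℝ, ⁅x, r⁆ = c • r := by
    obtain ⟨c, hc⟩ := hspan ⟨⁅x, r⁆, LieSubmodule.lie_mem _ hr⟩
    exact ⟨c, (congrArg Subtype.val hc).symm⟩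
  let K : Submodule ℝ g := LinearMap.ker (LieAlgebra.ad ℝ g r)
  have hK {x : g} : x ∈ K ↔ ⁅r, x⁆ = 0 := by simp [K]
  have hrK : r ∈ K := hK.mpr (lie_self r)
  have hKlt : Module.finrank ℝ K < 4 := by
    rw [← h4]
    exact Submodule.finrank_lt (fun h ↦ hx₀ (hK.mp (h ▸ Submodule.mem_top)))
  -- `r` spans an ideal, so it is an eigenvector of every `ad x`, and is killed by commutators.
  have hD : (LieAlgebra.derivedSeries ℝ g 1).toSubmodule ≤ K := by
    refine derivedSeries_succ_le (k := 0) (U := ⊤) le_top fun x _ y _ ↦ hK.mpr ?_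
    obtain ⟨c, hc⟩ := hchar x
    obtain ⟨d, hd⟩ := hchar y
    rw [← lie_skew, lie_lie, hc, hd, lie_smul, lie_smul, hc, hd, smul_comm, sub_self, neg_zero]
  obtain ⟨C, hC⟩ := (Submodule.span ℝ {r}).exists_isCompl
  have hrC : r ∉ C := fun h ↦ hr0' (Submodule.disjoint_def.mp hC.disjoint r
    (Submodule.mem_span_singleton_self r) h)
  have hKC : Module.finrank ℝ (K ⊓ C : Submodule ℝ g) ≤ 2 := by
    have : K ⊓ C < K := lt_of_le_of_ne inf_le_left fun h ↦ hrC (h.symm.le hrK).2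
    have := Submodule.finrank_lt_finrank_of_lt this
    omega
  obtain ⟨a, b, hab⟩ := (K ⊓ C).exists_le_span_pair hKC
  have hdec {x : g} (hx : x ∈ K) : ∃ s : ℝ, ∃ x' ∈ K ⊓ C, x = s • r + x' := by
    obtain ⟨u, hu, w, hw, rfl⟩ :=
      Submodule.mem_sup.mp (hC.sup_eq_top ▸ Submodule.mem_top : x ∈ Submodule.span ℝ {r} ⊔ C)
    obtain ⟨s, rfl⟩ := Submodule.mem_span_singleton.mp hu
    exact ⟨s, w, ⟨(K.add_mem_iff_right (K.smul_mem s hrK)).mp hx, hw⟩, rfl⟩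
  have hD₂ : (LieAlgebra.derivedSeries ℝ g 2).toSubmodule ≤ Submodule.span ℝ {⁅a, b⁆, 0} := by
    refine derivedSeries_succ_le hD fun x hx y hy ↦ ?_
    obtain ⟨s, x', hx', rfl⟩ := hdec hx
    obtain ⟨t, y', hy', rfl⟩ := hdec hy
    have h₁ := hK.mp hx'.1
    have h₂ := hK.mp hy'.1
    have h₃ : ⁅x', r⁆ = 0 := by rw [← lie_skew, h₁, neg_zero]
    have : ⁅s • r + x', t • r + y'⁆ = ⁅x', y'⁆ := by simp [h₂, h₃]
    rw [this]
    exact Submodule.span_mono (by simp) (lie_mem_span_of_mem_span_pair (hab hx') (hab hy'))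
  exact hns (isSolvable_of_derivedSeries_le_span_pair hD₂)

end Central

/-! ### An `sl₂`-triple from a two-dimensional subalgebra -/

section Triple

variable {g : Type*} [LieRing g] [LieAlgebra ℝ g]

/-- A nonabelian two-dimensional Lie algebra has a basis with `[x, y] = y`. The vector `v` records
that independence from a further vector survives the change of basis. -/
theorem exists_lie_eq_self_of_lie_mem_span {v p q : g} (hli : LinearIndependent ℝ ![v, p, q])
    (hpq : ⁅p, q⁆ ∈ Submodule.span ℝ {p, q}) (h0 : ⁅p, q⁆ ≠ 0) :
    ∃ x y : g, LinearIndependent ℝ ![v, x, y] ∧ ⁅x, y⁆ = y := by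
  obtain ⟨α, β, h⟩ := Submodule.mem_span_pair.mp hpq
  rw [Fintype.linearIndependent_iff] at hli
  have key (a b c : ℝ) (habc : a • v + b • p + c • q = 0) : a = 0 ∧ b = 0 ∧ c = 0 := by
    have := hli ![a, b, c] (by simpa [Fin.sum_univ_three] using habc)
    exact ⟨this 0, this 1, this 2⟩
  by_cases hβ : β = 0
  · have hα : α ≠ 0 := fun hα ↦ h0 (by simp [← h, hα, hβ])
    refine ⟨(-α⁻¹) • q, α • p, ?_, ?_⟩
    · refine Fintype.linearIndependent_iff.mpr fun c hc ↦ ?_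
      simp only [Fin.sum_univ_three, Matrix.cons_val] at hc
      obtain ⟨h₁, h₂, h₃⟩ := key (c 0) (c 2 * α) (-(c 1 * α⁻¹)) (by rw [← hc]; module)
      have h₄ : c 1 = 0 := (mul_eq_zero.mp (neg_eq_zero.mp h₃)).resolve_right (inv_ne_zero hα)
      have h₅ : c 2 = 0 := (mul_eq_zero.mp h₂).resolve_right hα
      intro i
      fin_cases i
      exacts [h₁, h₄, h₅]
    · rw [lie_smul, smul_lie, ← lie_skew, ← h, hβ]
      match_scalars <;> field_simp
  · refine ⟨β⁻¹ • p, α • p + β • q, ?_, ?_⟩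
    · refine Fintype.linearIndependent_iff.mpr fun c hc ↦ ?_
      simp only [Fin.sum_univ_three, Matrix.cons_val] at hc
      obtain ⟨h₁, h₂, h₃⟩ := key (c 0) (c 1 * β⁻¹ + c 2 * α) (c 2 * β) (by rw [← hc]; module)
      have h₄ : c 2 = 0 := (mul_eq_zero.mp h₃).resolve_right hβ
      rw [h₄, zero_mul, add_zero] at h₂
      have h₅ : c 1 = 0 := (mul_eq_zero.mp h₂).resolve_right (inv_ne_zero hβ)
      intro i
      fin_cases i
      exacts [h₁, h₅, h₄]
    · rw [lie_add, lie_smul, lie_smul, smul_lie, smul_lie, lie_self, ← h]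
      match_scalars <;> field_simp

theorem exists_eq_combination (h4 : Module.finrank ℝ g = 4) {z v x y : g}
    (hli : LinearIndependent ℝ ![z, v, x, y]) (w : g) :
    ∃ c k a b : ℝ, w = c • z + k • v + a • x + b • y := by
  let β := basisOfLinearIndependentOfCardEqFinrank hli (by simp [h4])
  have h := β.sum_repr w
  simp only [Fin.sum_univ_four, β, coe_basisOfLinearIndependentOfCardEqFinrank,
    Matrix.cons_val] at h
  exact ⟨_, _, _, _, h.symm⟩

theorem eq_zero_of_combination {z v x y : g}
    (hli : LinearIndependent ℝ ![z, v, x, y]) {c k a b : ℝ}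
    (h : c • z + k • v + a • x + b • y = 0) : c = 0 ∧ k = 0 ∧ a = 0 ∧ b = 0 := by
  have := Fintype.linearIndependent_iff.mp hli ![c, k, a, b] (by simpa [Fin.sum_univ_four] using h)
  exact ⟨this 0, this 1, this 2, this 3⟩

/-- Extend `v`, `p`, `q` to a basis by `z`. Unless the bracket relations are those of an
`sl₂`-triple, up to a change of basis, the algebra is solvable. -/
theorem exists_sl2_triple (h4 : Module.finrank ℝ g = 4)
    (hns : ¬ LieAlgebra.IsSolvable g) {v p q : g} (hv : ∀ x : g, ⁅v, x⁆ = 0)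
    (hli : LinearIndependent ℝ ![v, p, q]) (hpq : ⁅p, q⁆ ∈ Submodule.span ℝ {p, q}) :
    ∃ h e f : g, LinearIndependent ℝ ![f, v, h, e] ∧ ⁅h, e⁆ = (2 : ℝ) • e ∧
      ⁅h, f⁆ = -(2 : ℝ) • f ∧ ⁅e, f⁆ = h := by
  have hv' (x : g) : ⁅x, v⁆ = 0 := by rw [← lie_skew, hv, neg_zero]
  -- If `p` and `q` commute, all brackets are combinations of `[z, p]` and `[z, q]`.
  have h0 : ⁅p, q⁆ ≠ 0 := by
    intro h0
    obtain ⟨z, hz⟩ := exists_linearIndependent_cons_of_lt_finrank hli (by omega)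
    replace hz : LinearIndependent ℝ ![z, v, p, q] := hz
    have h0' : ⁅q, p⁆ = 0 := by rw [← lie_skew, h0, neg_zero]
    refine hns (isSolvable_of_derivedSeries_le_span_pair (k := 1) (a := ⁅z, p⁆) (b := ⁅z, q⁆) ?_)
    refine derivedSeries_succ_le (k := 0) (U := ⊤) le_top fun s _ t _ ↦ ?_
    obtain ⟨c, k, a, b, rfl⟩ := exists_eq_combination h4 hz s
    obtain ⟨c', k', a', b', rfl⟩ := exists_eq_combination h4 hz t
    refine Submodule.mem_span_pair.mpr ⟨c * a' - a * c', c * b' - b * c', ?_⟩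
    simp only [lie_add, add_lie, lie_smul, smul_lie, lie_self, hv, hv', h0, h0', ← lie_skew p z,
      ← lie_skew q z]
    module
  obtain ⟨x, y, hli', hxy⟩ := exists_lie_eq_self_of_lie_mem_span hli hpq h0
  obtain ⟨z, hz⟩ := exists_linearIndependent_cons_of_lt_finrank hli' (by omega)
  replace hz : LinearIndependent ℝ ![z, v, x, y] := hz
  obtain ⟨c, k, a, b, hxz⟩ := exists_eq_combination h4 hz ⁅x, z⁆
  obtain ⟨f, l, d, e, hyz⟩ := exists_eq_combination h4 hz ⁅y, z⁆
  have hyx : ⁅y, x⁆ = -y := by rw [← lie_skew, hxy]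
  -- The four coordinates of the Jacobi identity for `x`, `y`, `z`.
  have hjac := leibniz_lie x y z
  obtain ⟨j₁, j₂, j₃, j₄⟩ := eq_zero_of_combination hz (c := -f) (k := f * k - (1 + c) * l)
    (a := f * a - (1 + c) * d) (b := f * b - c * e + a) (by
      rw [hxy, hyz, hxz] at hjac
      simp only [lie_add, lie_smul, lie_self, hv', hxy, hyx, hxz, hyz] at hjac
      rw [← sub_eq_zero] at hjac
      rw [← hjac]
      module)
  have hf : f = 0 := by linarith
  subst hf
  -- If `d = 0`, the derived algebra lies in the span of `y`, `v` and `[x, z]`, where `v` is central,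
  -- so the second derived algebra is at most a line.
  have hd : d ≠ 0 := by
    rintro rfl
    have h₁ : (LieAlgebra.derivedSeries ℝ g 1).toSubmodule ≤ Submodule.span ℝ {y, v, ⁅x, z⁆} := by
      refine derivedSeries_succ_le (k := 0) (U := ⊤) le_top fun s _ t _ ↦ ?_
      obtain ⟨c₁, k₁, a₁, b₁, rfl⟩ := exists_eq_combination h4 hz s
      obtain ⟨c₂, k₂, a₂, b₂, rfl⟩ := exists_eq_combination h4 hz t
      refine Submodule.mem_span_triple.mpr ⟨a₁ * b₂ - b₁ * a₂ + (b₁ * c₂ - c₁ * b₂) * e,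
        (b₁ * c₂ - c₁ * b₂) * l, a₁ * c₂ - c₁ * a₂, ?_⟩
      simp only [lie_add, add_lie, lie_smul, smul_lie, lie_self, hv, hv', ← lie_skew z x,
        ← lie_skew z y, hxy, hyx, hyz]
      rw [hxz]
      module
    have h₂ : (LieAlgebra.derivedSeries ℝ g 2).toSubmodule ≤ Submodule.span ℝ {⁅y, ⁅x, z⁆⁆, 0} := by
      refine derivedSeries_succ_le h₁ fun s hs t ht ↦ ?_
      obtain ⟨a₁, b₁, c₁, rfl⟩ := Submodule.mem_span_triple.mp hs
      obtain ⟨a₂, b₂, c₂, rfl⟩ := Submodule.mem_span_triple.mp ht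
      refine Submodule.mem_span_pair.mpr ⟨a₁ * c₂ - c₁ * a₂, 0, ?_⟩
      simp only [lie_add, add_lie, lie_smul, smul_lie, lie_self, hv, hv', ← lie_skew ⁅x, z⁆ y]
      module
    exact hns (isSolvable_of_derivedSeries_le_span_pair h₂)
  have hc : c = -1 := by
    have : (1 + c) * d = 0 := by linarith
    rcases mul_eq_zero.mp this with h | h
    · linarith
    · exact absurd h hd
  subst hc
  have he : e = -a := by linarith
  subst he
  -- Now `[x, z] = a x + b y - z + k v` and `[y, z] = d x - a y + l v`. Subtracting
  -- `a x + (b / 2) y + k v` from `z` gives an eigenvector of `ad x` with eigenvalue `-1`, whose bracket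
  -- with `y` is `d x + l v`; the remaining constants normalise the triple.
  refine ⟨(2 : ℝ) • x + (2 * l / d) • v, y,
    (2 / d) • (z - a • x - (b / 2) • y - k • v), ?_, ?_, ?_, ?_⟩
  · refine Fintype.linearIndependent_iff.mpr fun w hw ↦ ?_
    simp only [Fin.sum_univ_four, Matrix.cons_val] at hw
    obtain ⟨i₁, i₂, i₃, i₄⟩ := eq_zero_of_combination hz (c := w 0 * (2 / d))
      (k := w 1 + w 2 * (2 * l / d) - w 0 * (2 / d) * k)
      (a := 2 * w 2 - w 0 * (2 / d) * a) (b := w 3 - w 0 * (2 / d) * (b / 2))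
      (by rw [← hw]; module)
    have w0 : w 0 = 0 := by
      rcases mul_eq_zero.mp i₁ with h | h
      · exact h
      · exact absurd h (by positivity)
    rw [w0] at i₂ i₃ i₄
    have w2 : w 2 = 0 := by linarith
    rw [w2] at i₂
    intro i
    fin_cases i
    · exact w0
    · change w 1 = 0; linarith
    · exact w2
    · change w 3 = 0; linarith
  · simp only [add_lie, smul_lie, hv, hxy]
    module
  · simp only [add_lie, smul_lie, lie_smul, lie_sub, hv, hv', hxy, hxz, lie_self]
    module
  · simp only [lie_smul, lie_sub, hv', hyx, hyz, lie_self]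
    match_scalars <;> field_simp <;> ring

end Triple

/-! ### The eigenspaces of the product structure -/

section Eigenspaces

variable {g : Type*} [LieRing g] [LieAlgebra ℝ g]

/-- The eigenspaces of `J₂` for `1` and `-1` are complementary, are subalgebras by the integrability
of `J₂`, and are exchanged by `J₁`. -/
theorem AdmitsParaHypercomplex.exists_subalgebra_pair (h4 : Module.finrank ℝ g = 4)
    (hg : AdmitsParaHypercomplex g) :
    ∃ P M : Submodule ℝ g, Disjoint P M ∧ Module.finrank ℝ P = 2 ∧ Module.finrank ℝ M = 2 ∧
      (∀ x ∈ P, ∀ y ∈ P, ⁅x, y⁆ ∈ P) ∧ (∀ x ∈ M, ∀ y ∈ M, ⁅x, y⁆ ∈ M) := by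
  have : Module.Finite ℝ g := Module.finite_of_finrank_pos (by omega)
  obtain ⟨J₁, J₂, hJ⟩ := hg
  have hsq₁ (x : g) : J₁ (J₁ x) = -x := LinearMap.congr_fun hJ.isComplex x
  have hsq₂ (x : g) : J₂ (J₂ x) = x := LinearMap.congr_fun hJ.isProduct.1 x
  have hanti (x : g) : J₁ (J₂ x) = -J₂ (J₁ x) := LinearMap.congr_fun hJ.anticomm x
  let P : Submodule ℝ g := LinearMap.eqLocus J₂ LinearMap.id
  let M : Submodule ℝ g := LinearMap.eqLocus J₂ (-LinearMap.id)
  have hP {x : g} : x ∈ P ↔ J₂ x = x := Iff.rfl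
  have hM {x : g} : x ∈ M ↔ J₂ x = -x := Iff.rfl
  have two {x : g} (h : x = -x) : x = 0 := by
    have : (2 : ℝ) • x = 0 := by rw [two_smul]; nth_rw 2 [h]; exact add_neg_cancel x
    simpa using this
  have hdisj : Disjoint P M := Submodule.disjoint_def.mpr fun x hx hx' ↦
    two ((hP.mp hx).symm.trans (hM.mp hx'))
  have hsup : P ⊔ M = ⊤ := by
    refine eq_top_iff.mpr fun x _ ↦ Submodule.mem_sup.mpr
      ⟨(2⁻¹ : ℝ) • (x + J₂ x), ?_, (2⁻¹ : ℝ) • (x - J₂ x), ?_, by module⟩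
    · rw [hP, map_smul, map_add, hsq₂, add_comm]
    · rw [hM, map_smul, map_sub, hsq₂]; module
  have hinj : Function.Injective J₁ := fun x y hxy ↦ by
    have := congrArg J₁ hxy
    rwa [hsq₁, hsq₁, neg_inj] at this
  have hPM : Module.finrank ℝ P ≤ Module.finrank ℝ M :=
    LinearMap.finrank_le_finrank_of_injective (f := J₁.restrict (p := P) (q := M) fun x hx ↦ by
      have := hanti x
      rw [hP.mp hx] at this
      rw [hM, ← neg_eq_iff_eq_neg]; exact this.symm)
      fun x y hxy ↦ Subtype.ext (hinj (congrArg Subtype.val hxy))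
  have hMP : Module.finrank ℝ M ≤ Module.finrank ℝ P :=
    LinearMap.finrank_le_finrank_of_injective (f := J₁.restrict (p := M) (q := P) fun x hx ↦ by
      have := hanti x
      rw [hM.mp hx, map_neg, neg_inj] at this
      rw [hP, ← this]) fun x y hxy ↦ Subtype.ext (hinj (congrArg Subtype.val hxy))
  have hsum := Submodule.finrank_sup_add_finrank_inf_eq P M
  rw [hsup, hdisj.eq_bot, finrank_top, finrank_bot, h4] at hsum
  refine ⟨P, M, hdisj, by omega, by omega, fun x hx y hy ↦ ?_, fun x hx y hy ↦ ?_⟩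
  · have h := hJ.integrable₂ x y
    rw [hP.mp hx, hP.mp hy] at h
    have : (2 : ℝ) • (⁅x, y⁆ - J₂ ⁅x, y⁆) = 0 := by rw [← h]; module
    rw [hP]
    exact (sub_eq_zero.mp ((smul_eq_zero.mp this).resolve_left two_ne_zero)).symm
  · have h := hJ.integrable₂ x y
    rw [hM.mp hx, hM.mp hy] at h
    simp only [lie_neg, neg_lie, map_neg, neg_neg] at h
    have : (2 : ℝ) • (J₂ ⁅x, y⁆ - -⁅x, y⁆) = 0 := by rw [← h]; module
    rw [hM]
    exact sub_eq_zero.mp ((smul_eq_zero.mp this).resolve_left two_ne_zero)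

theorem exists_linearIndependent_of_notMem {P : Submodule ℝ g} {v : g}
    (h2 : Module.finrank ℝ P = 2) (hP : ∀ x ∈ P, ∀ y ∈ P, ⁅x, y⁆ ∈ P) (hv : v ∉ P) :
    ∃ p q : g, LinearIndependent ℝ ![v, p, q] ∧ ⁅p, q⁆ ∈ Submodule.span ℝ {p, q} := by
  have : Module.Finite ℝ P := Module.finite_of_finrank_pos (by omega)
  let β := Module.finBasisOfFinrankEq ℝ P h2
  have hspan : Submodule.span ℝ {(β 0 : g), (β 1 : g)} = P := by
    refine le_antisymm (Submodule.span_le.mpr ?_) fun x hx ↦ ?_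
    · rintro _ (rfl | rfl) <;> exact Subtype.property _
    · have := congrArg Subtype.val (β.sum_repr ⟨x, hx⟩)
      rw [Fin.sum_univ_two] at this
      exact Submodule.mem_span_pair.mpr ⟨_, _, this⟩
  refine ⟨β 0, β 1, ?_, ?_⟩
  · have hli : LinearIndependent ℝ ![(β 0 : g), (β 1 : g)] := by
      have := β.linearIndependent.map' P.subtype P.ker_subtype
      have hcomp : P.subtype ∘ β = ![(β 0 : g), (β 1 : g)] := by
        ext i; fin_cases i <;> rfl
      rwa [hcomp] at this
    refine linearIndependent_finCons.mpr ⟨hli, ?_⟩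
    rwa [Matrix.range_cons, Matrix.range_cons, Matrix.range_empty, Set.union_empty,
      Set.singleton_union, hspan]
  · rw [hspan]
    exact hP _ (β 0).2 _ (β 1).2

/-- At most one of the two eigenspaces of `J₂` contains `v`; the other one provides `p` and `q`. -/
theorem AdmitsParaHypercomplex.exists_linearIndependent (h4 : Module.finrank ℝ g = 4)
    (hg : AdmitsParaHypercomplex g) {v : g} (hv : v ≠ 0) :
    ∃ p q : g, LinearIndependent ℝ ![v, p, q] ∧ ⁅p, q⁆ ∈ Submodule.span ℝ {p, q} := by
  obtain ⟨P, M, hdisj, hP, hM, hPlie, hMlie⟩ := hg.exists_subalgebra_pair h4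
  by_cases hvP : v ∈ P
  · exact exists_linearIndependent_of_notMem hM hMlie fun hvM ↦
      hv (Submodule.disjoint_def.mp hdisj v hvP hvM)
  · exact exists_linearIndependent_of_notMem hP hPlie hvP

theorem AdmitsParaHypercomplex.congr {g' : Type*} [LieRing g'] [LieAlgebra ℝ g'] (e : g ≃ₗ⁅ℝ⁆ g')
    (h : AdmitsParaHypercomplex g') : AdmitsParaHypercomplex g := by
  obtain ⟨J₁, J₂, hJ⟩ := h
  let E : g ≃ₗ[ℝ] g' := e.toLinearEquiv
  have hE (x y : g) : E ⁅x, y⁆ = ⁅E x, E y⁆ := LieHom.map_lie e.toLieHom x y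
  have hE' (x y : g') : E.symm ⁅x, y⁆ = ⁅E.symm x, E.symm y⁆ := LieHom.map_lie e.symm.toLieHom x y
  have h₂ (x) : J₂ (J₂ x) = x := LinearMap.congr_fun hJ.isProduct.1 x
  have h₁ (x) : J₁ (J₁ x) = -x := LinearMap.congr_fun hJ.isComplex x
  have h₃ (x) : J₁ (J₂ x) = -J₂ (J₁ x) := LinearMap.congr_fun hJ.anticomm x
  refine ⟨E.symm ∘ₗ J₁ ∘ₗ E, E.symm ∘ₗ J₂ ∘ₗ E, ?_, ⟨?_, fun h ↦ ?_, fun h ↦ ?_⟩, ?_,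
    fun x y ↦ ?_, fun x y ↦ ?_⟩
  · ext x; simp [h₁]
  · ext x; simp [h₂]
  · apply hJ.isProduct.2.1
    ext x
    have := congrArg E (LinearMap.congr_fun h (E.symm x))
    simpa using this
  · apply hJ.isProduct.2.2
    ext x
    have := congrArg E (LinearMap.congr_fun h (E.symm x))
    simpa using this
  · ext x; simp [h₃]
  · apply E.injective
    simpa [hE] using hJ.integrable₁ (E x) (E y)
  · apply E.injective
    simpa [hE] using hJ.integrable₂ (E x) (E y)

end Eigenspaces

/-! ### The algebra `ℝ ⊕ sl₂(ℝ)` as `2 × 2` matrices -/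

/-- For `a² = ±1` this is the vanishing of the Nijenhuis tensor of left multiplication by `a`. -/
theorem matrix_lie_mulLeft {n : Type*} [Fintype n] [DecidableEq n] (a x y : Matrix n n ℝ) :
    ⁅a * x, a * y⁆ - a * ⁅x, a * y⁆ - a * ⁅a * x, y⁆ + a * a * ⁅x, y⁆ = 0 := by
  simp only [Ring.lie_def]
  noncomm_ring

/-- The matrices used are anticommuting units of the split quaternions. -/
theorem admitsParaHypercomplex_matrix : AdmitsParaHypercomplex (Matrix (Fin 2) (Fin 2) ℝ) := by
  have hi : !![(0 : ℝ), -1; 1, 0] * !![0, -1; 1, 0] = -1 := by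
    simp [Matrix.one_fin_two]
  have hj : !![(1 : ℝ), 0; 0, -1] * !![1, 0; 0, -1] = 1 := by
    simp [Matrix.one_fin_two]
  have hij : !![(0 : ℝ), -1; 1, 0] * !![1, 0; 0, -1] = -(!![1, 0; 0, -1] * !![0, -1; 1, 0]) := by
    simp
  refine ⟨LinearMap.mulLeft ℝ !![0, -1; 1, 0], LinearMap.mulLeft ℝ !![1, 0; 0, -1],
    ?_, ⟨?_, fun h ↦ ?_, fun h ↦ ?_⟩, ?_, fun x y ↦ ?_, fun x y ↦ ?_⟩
  · refine LinearMap.ext fun x ↦ ?_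
    simp [← mul_assoc, hi, -Matrix.cons_mul]
  · refine LinearMap.ext fun x ↦ ?_
    simp [← mul_assoc, hj, -Matrix.cons_mul]
  · have := congrFun (congrFun (LinearMap.congr_fun h 1) 1) 1
    norm_num at this
  · have := congrFun (congrFun (LinearMap.congr_fun h 1) 0) 0
    norm_num at this
  · refine LinearMap.ext fun x ↦ ?_
    simp [← mul_assoc, hij, -Matrix.cons_mul]
  · have := matrix_lie_mulLeft !![(0 : ℝ), -1; 1, 0] x y
    rw [hi, neg_one_mul, ← sub_eq_add_neg] at this
    exact this
  · have := matrix_lie_mulLeft !![(1 : ℝ), 0; 0, -1] x y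
    rw [hj, one_mul] at this
    exact this

/-- The standard basis of `sl₂` stays in every term of the derived series. -/
theorem not_isSolvable_matrix : ¬ LieAlgebra.IsSolvable (Matrix (Fin 2) (Fin 2) ℝ) := by
  intro h
  obtain ⟨k, hk⟩ := LieAlgebra.IsSolvable.solvable ℝ (Matrix (Fin 2) (Fin 2) ℝ)
  let H : Matrix (Fin 2) (Fin 2) ℝ := !![1, 0; 0, -1]
  let E : Matrix (Fin 2) (Fin 2) ℝ := !![0, 1; 0, 0]
  let F : Matrix (Fin 2) (Fin 2) ℝ := !![0, 0; 1, 0]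
  have key (n : ℕ) : H ∈ LieAlgebra.derivedSeries ℝ (Matrix (Fin 2) (Fin 2) ℝ) n ∧
      E ∈ LieAlgebra.derivedSeries ℝ (Matrix (Fin 2) (Fin 2) ℝ) n ∧
      F ∈ LieAlgebra.derivedSeries ℝ (Matrix (Fin 2) (Fin 2) ℝ) n := by
    induction n with
    | zero => exact ⟨LieSubmodule.mem_top _, LieSubmodule.mem_top _, LieSubmodule.mem_top _⟩
    | succ n ih =>
      obtain ⟨hH, hE, hF⟩ := ih
      rw [LieAlgebra.derivedSeries_def, LieAlgebra.derivedSeriesOfIdeal_succ]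
      rw [LieAlgebra.derivedSeries_def] at hH hE hF
      have e₁ : H = ⁅E, F⁆ := by simp [H, E, F, Ring.lie_def]
      have e₂ : E = (2⁻¹ : ℝ) • ⁅H, E⁆ := by
        ext i j; fin_cases i <;> fin_cases j <;> norm_num [H, E, Ring.lie_def]
      have e₃ : F = (-2⁻¹ : ℝ) • ⁅H, F⁆ := by
        ext i j; fin_cases i <;> fin_cases j <;> norm_num [H, F, Ring.lie_def]
      refine ⟨?_, ?_, ?_⟩
      · rw [e₁]; exact LieSubmodule.lie_mem_lie hE hF
      · rw [e₂]; exact Submodule.smul_mem _ _ (LieSubmodule.lie_mem_lie hH hE)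
      · rw [e₃]; exact Submodule.smul_mem _ _ (LieSubmodule.lie_mem_lie hH hF)
  have := (key k).2.1
  rw [hk, LieSubmodule.mem_bot] at this
  have := congrFun (congrFun this 0) 1
  norm_num [E] at this

theorem sl2_apply_one_one (A : LieAlgebra.SpecialLinear.sl (Fin 2) ℝ) : A.1 1 1 = -A.1 0 0 := by
  have h : Matrix.trace A.1 = 0 := A.2
  rw [Matrix.trace_fin_two] at h
  linarith

/-- The isomorphism of `ℝ ⊕ sl₂(ℝ)` with all `2 × 2` matrices, `(t, A) ↦ t • 1 + A`. -/
noncomputable def rSumSl2EquivMatrix : RSumSl2 ≃ₗ⁅ℝ⁆ Matrix (Fin 2) (Fin 2) ℝ where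
  toFun x := x.1 • (1 : Matrix (Fin 2) (Fin 2) ℝ) + x.2.1
  map_add' x y := by simp [add_smul]; abel
  map_smul' c x := by simp [mul_smul]
  map_lie' {x y} := by
    have h : ⁅x.1, y.1⁆ = 0 := by simp [Ring.lie_def, mul_comm]
    simp [LieAlgebra.Prod.bracket_apply, h, Ring.lie_def, mul_add, add_mul]
    module
  invFun A := (A.trace / 2, ⟨A - (A.trace / 2) • 1, by
    change Matrix.trace (n := Fin 2) (R := ℝ) _ = 0
    simp⟩)
  left_inv x := by
    have h : Matrix.trace x.2.1 = 0 := x.2.2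
    ext <;> simp [h]
  right_inv A := by simp

theorem finrank_rSumSl2 : Module.finrank ℝ RSumSl2 = 4 := by
  rw [rSumSl2EquivMatrix.toLinearEquiv.finrank_eq, Module.finrank_matrix]
  simp

theorem nonempty_lieEquiv_rSumSl2 {g : Type*} [LieRing g] [LieAlgebra ℝ g]
    (h4 : Module.finrank ℝ g = 4) {v h e f : g} (hv : ∀ x : g, ⁅v, x⁆ = 0)
    (hli : LinearIndependent ℝ ![f, v, h, e]) (hhe : ⁅h, e⁆ = (2 : ℝ) • e)
    (hhf : ⁅h, f⁆ = -(2 : ℝ) • f) (hef : ⁅e, f⁆ = h) : Nonempty (g ≃ₗ⁅ℝ⁆ RSumSl2) := by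
  have hv' (x : g) : ⁅x, v⁆ = 0 := by rw [← lie_skew, hv, neg_zero]
  have heh : ⁅e, h⁆ = -(2 : ℝ) • e := by rw [← lie_skew, hhe, neg_smul]
  have hfh : ⁅f, h⁆ = (2 : ℝ) • f := by rw [← lie_skew, hhf, neg_smul, neg_neg]
  have hfe : ⁅f, e⁆ = -h := by rw [← lie_skew, hef]
  let φ : RSumSl2 →ₗ⁅ℝ⁆ g :=
    { toFun := fun x ↦ x.2.1 1 0 • f + x.1 • v + x.2.1 0 0 • h + x.2.1 0 1 • e
      map_add' := fun x y ↦ by simp; module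
      map_smul' := fun c x ↦ by simp; module
      map_lie' := fun {x y} ↦ by
        have hx := sl2_apply_one_one x.2
        have hy := sl2_apply_one_one y.2
        have h₀ : ⁅x.1, y.1⁆ = 0 := by simp [Ring.lie_def, mul_comm]
        simp only [LieAlgebra.Prod.bracket_apply, h₀, LieAlgebra.SpecialLinear.sl_bracket,
          Matrix.sub_apply, Matrix.mul_apply, Fin.sum_univ_two, hx, hy, lie_add, add_lie, lie_smul,
          smul_lie, lie_self, hv, hv', hhe, hhf, hef, heh, hfh, hfe]
        module }
  have hbij : Function.Bijective φ := by
    constructor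
    · refine (injective_iff_map_eq_zero φ).mpr fun x hx ↦ ?_
      obtain ⟨h₁, h₂, h₃, h₄⟩ := eq_zero_of_combination hli hx
      refine Prod.ext h₂ (Subtype.ext ?_)
      ext i j
      fin_cases i <;> fin_cases j
      · exact h₃
      · exact h₄
      · exact h₁
      · have := sl2_apply_one_one x.2
        rw [h₃, neg_zero] at this
        exact this
    · intro w
      obtain ⟨c, k, a, b, rfl⟩ := exists_eq_combination h4 hli w
      refine ⟨(k, ⟨!![a, b; c, -a], ?_⟩), ?_⟩
      · change Matrix.trace (n := Fin 2) (R := ℝ) _ = 0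
        simp [Matrix.trace_fin_two]
      · simp [φ]
  exact ⟨(LieEquiv.ofBijective φ hbij).symm⟩

/-! ### The algebra `ℝ ⊕ so(3)` -/

/-- The linear coordinates of a skew-symmetric `3 × 3` matrix given by its entries above the
diagonal, in the order `(0, 1)`, `(0, 2)`, `(1, 2)`. -/
def so3Equiv : LieAlgebra.Orthogonal.so (Fin 3) ℝ ≃ₗ[ℝ] (Fin 3 → ℝ) where
  toFun A := ![A.1 0 1, A.1 0 2, A.1 1 2]
  map_add' A B := by ext i; fin_cases i <;> simp
  map_smul' c A := by ext i; fin_cases i <;> simp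
  invFun u := ⟨!![0, u 0, u 1; -u 0, 0, u 2; -u 1, -u 2, 0], by
    rw [LieAlgebra.Orthogonal.mem_so]
    ext i j; fin_cases i <;> fin_cases j <;> simp⟩
  left_inv A := by
    have h (i j) : A.1 j i = -A.1 i j :=
      congrFun (congrFun ((LieAlgebra.Orthogonal.mem_so _ _ _).mp A.2) i) j
    refine Subtype.ext ?_
    ext i j
    fin_cases i <;> fin_cases j <;> simp <;> linarith [h 0 0, h 1 1, h 2 2, h 0 1, h 0 2, h 1 2]
  right_inv u := by ext i; fin_cases i <;> simp

/-- In these coordinates the bracket is the cross product up to signs and order. -/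
theorem so3Equiv_lie (A B : LieAlgebra.Orthogonal.so (Fin 3) ℝ) :
    so3Equiv ⁅A, B⁆ = ![so3Equiv A 2 * so3Equiv B 1 - so3Equiv A 1 * so3Equiv B 2,
      so3Equiv A 0 * so3Equiv B 2 - so3Equiv A 2 * so3Equiv B 0,
      so3Equiv A 1 * so3Equiv B 0 - so3Equiv A 0 * so3Equiv B 1] := by
  have h (A : LieAlgebra.Orthogonal.so (Fin 3) ℝ) (i j) : A.1 j i = -A.1 i j :=
    congrFun (congrFun ((LieAlgebra.Orthogonal.mem_so _ _ _).mp A.2) i) j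
  have hd (A : LieAlgebra.Orthogonal.so (Fin 3) ℝ) (i) : A.1 i i = 0 := by linarith [h A i i]
  ext i
  fin_cases i <;>
    simp [so3Equiv, LieSubalgebra.coe_bracket, Ring.lie_def, Matrix.mul_apply, Fin.sum_univ_three,
      hd, h A 0 1, h A 1 2, h B 0 1, h B 1 2] <;> ring

theorem finrank_rSumSo3 : Module.finrank ℝ RSumSo3 = 4 := by
  have : Module.Finite ℝ (LieAlgebra.Orthogonal.so (Fin 3) ℝ) := Module.Finite.equiv so3Equiv.symm
  rw [Module.finrank_prod, so3Equiv.finrank_eq]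
  simp

/-- A two-dimensional subalgebra not containing the centre would project to a two-dimensional
subalgebra of `so(3)`; but a cross product is orthogonal to its factors, so it lies in their span
only if it vanishes, and then the factors are dependent. -/
theorem not_admitsParaHypercomplex_rSumSo3 : ¬ AdmitsParaHypercomplex RSumSo3 := by
  intro hadm
  obtain ⟨p, q, hli, hpq⟩ := hadm.exists_linearIndependent finrank_rSumSo3 (v := (1, 0)) (by simp)
  obtain ⟨α, β, h⟩ := Submodule.mem_span_pair.mp hpq
  have h' := congrArg so3Equiv (congrArg Prod.snd h)
  simp only [LieAlgebra.Prod.bracket_apply, so3Equiv_lie, Prod.snd_add, Prod.smul_snd, map_add,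
    map_smul] at h'
  have e₀ := congrFun h' 0
  have e₁ := congrFun h' 1
  have e₂ := congrFun h' 2
  simp only [Pi.add_apply, Pi.smul_apply, smul_eq_mul, Matrix.cons_val] at e₀ e₁ e₂
  have hli' (a b c : ℝ) (habc : a • ((1, 0) : RSumSo3) + b • p + c • q = 0) : b = 0 ∧ c = 0 := by
    have := Fintype.linearIndependent_iff.mp hli ![a, b, c]
      (by simpa [Fin.sum_univ_three] using habc)
    exact ⟨this 1, this 2⟩
  -- A relation between the `so(3)`-components lifts to one between `(1, 0)`, `p` and `q`.
  have hdep (b c : ℝ) (hbc : ∀ i, b * so3Equiv p.2 i + c * so3Equiv q.2 i = 0) : b = 0 ∧ c = 0 := by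
    refine hli' (-(b * p.1 + c * q.1)) b c (Prod.ext (by simp) ?_)
    apply so3Equiv.injective
    ext i
    simpa using hbc i
  generalize so3Equiv p.2 = s at *
  generalize so3Equiv q.2 = t at *
  -- The combination is the scalar product of `[p, q] = α p + β q` with `[p, q]`.
  have hzero : (s 2 * t 1 - s 1 * t 2) ^ 2 + (s 0 * t 2 - s 2 * t 0) ^ 2
      + (s 1 * t 0 - s 0 * t 1) ^ 2 = 0 := by
    linear_combination -(s 2 * t 1 - s 1 * t 2) * e₀ - (s 0 * t 2 - s 2 * t 0) * e₁
      - (s 1 * t 0 - s 0 * t 1) * e₂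
  have z₀ : s 2 * t 1 - s 1 * t 2 = 0 := by nlinarith
  have z₁ : s 0 * t 2 - s 2 * t 0 = 0 := by nlinarith
  have z₂ : s 1 * t 0 - s 0 * t 1 = 0 := by nlinarith
  have hs (i : Fin 3) : s i = 0 := by
    refine neg_eq_zero.mp (hdep (t i) (-s i) fun j ↦ ?_).2
    fin_cases i <;> fin_cases j <;> simp <;> linarith
  exact one_ne_zero (hdep 1 0 fun i ↦ by simp [hs]).1

/-! ### The classification -/

theorem corollary3p1 :
    (∀ (g : Type*) [LieRing g] [LieAlgebra ℝ g],
      (Module.finrank ℝ g = 4 ∧ ¬ LieAlgebra.IsSolvable g ∧ AdmitsParaHypercomplex g) ↔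
        Nonempty (g ≃ₗ⁅ℝ⁆ RSumSl2)) ∧
    ¬ AdmitsParaHypercomplex RSumSo3 := by
  refine ⟨fun g _ _ ↦ ⟨?_, ?_⟩, not_admitsParaHypercomplex_rSumSo3⟩
  · rintro ⟨h4, hns, hadm⟩
    obtain ⟨v, hv0, hv⟩ := exists_central_of_not_isSolvable h4 hns
    obtain ⟨p, q, hli, hpq⟩ := hadm.exists_linearIndependent h4 hv0
    obtain ⟨h, e, f, hli', hhe, hhf, hef⟩ := exists_sl2_triple h4 hns hv hli hpq
    exact nonempty_lieEquiv_rSumSl2 h4 hv hli' hhe hhf hef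
  · rintro ⟨e⟩
    let E : g ≃ₗ⁅ℝ⁆ Matrix (Fin 2) (Fin 2) ℝ := e.trans rSumSl2EquivMatrix
    refine ⟨?_, fun h ↦ ?_, admitsParaHypercomplex_matrix.congr E⟩
    · rw [e.toLinearEquiv.finrank_eq, finrank_rSumSl2]
    · exact not_isSolvable_matrix
        (Function.Injective.lieAlgebra_isSolvable (f := E.symm.toLieHom) E.symm.injective)
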